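/- Rings are associative with $1$ and modules are unital. A ring $R$ is von Neumann regular if for every $a\in R$ there is $x\in R$ with $axa=a$. For a left or right $R$-module $P$ let $L(P)$ be the set of finitely generated submodules of $P$, ordered by inclusion. A partially ordered set is complete if each of its subsets has a supremum and an infimum. It is upper continuous if it is complete and $a\wedge\bigvee_i b_i=\bigvee_i (a\wedge b_i)$ for every element $a$ and every linearly ordered subset $\{b_i\}$; it is lower continuous if it is complete and $a\vee\bigwedge_i b_i=\bigwedge_i (a\vee b_i)$ for all such $a$ and $\{b_i\}$. The ring $R$ is right (left) self-injective if it is injective as a right (left) module over itself. It is right (left) $\pi$-coherent if for every set $I$ every finitely generated right (left) submodule of $R^I$ is finitely presented. Write $R_R^n$ and ${}_RR^n$ for $R^n$ regarded as a right, respectively left, $R$-module. Proposition. Let $R$ be a von Neumann regular ring. (a) The following are equivalent: (i) $R$ is right self-injective; (ii) $L(R_R^n)$ is upper continuous for every $n\in\mathbb N$; (iii) $L(R_R^2)$ is upper continuous; (iv) $L(R_R)$ is upper continuous and $L(R_R^2)$ is complete. (b) The following are equivalent: (i) $R$ is left self-injective; (ii) $L({}_RR^n)$ is upper continuous for every $n\in\mathbb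 N$; (iii) $L({}_RR^2)$ is upper continuous; (iv) $L({}_RR)$ is upper continuous and $L({}_RR^2)$ is complete; (ii$'$) $L(R_R^n)$ is lower continuous for every $n\in\mathbb N$; (iii$'$) $L(R_R^2)$ is lower continuous; (iv$'$) $L(R_R)$ is lower continuous and $L(R_R^2)$ is complete. (c) If $R$ is left or right self-injective, then $R$ is both left and right $\pi$-coherent. -/

import Mathlib

universe u v

/-- A ring is von Neumann regular if every element `a` has a quasi-inverse `x`: `a x a = a`. -/
def IsVNRegular (R : Type u) [Ring R] : Prop :=
  ∀ a : R, ∃ x : R, a * x * a = a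

/-- `L(P)`: the finitely generated `A`-submodules of the `A`-module `P`, ordered by inclusion. -/
abbrev FGLattice (A : Type*) (P : Type*) [Ring A] [AddCommGroup P] [Module A P] : Type _ :=
  {N : Submodule A P // N.FG}

/-- A partially ordered set is a complete lattice: every subset has a supremum and an infimum. -/
def IsCompleteOrder (α : Type*) [PartialOrder α] : Prop :=
  ∀ S : Set α, (∃ s, IsLUB S s) ∧ ∃ t, IsGLB S t

/-- Upper continuity: the order is a complete lattice, and `a ⊓ ⨆ C = ⨆ c ∈ C, a ⊓ c` for every
element `a` and every linearly ordered subset `C`. -/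
structure IsUpperContinuous (α : Type*) [PartialOrder α] : Prop where
  complete : IsCompleteOrder α
  inf_sup : ∀ (a : α) (C : Set α), IsChain (· ≤ ·) C →
    ∀ s m : α, IsLUB C s → IsGLB {a, s} m → IsLUB {x | ∃ c ∈ C, IsGLB {a, c} x} m

/-- Lower continuity: the order is a complete lattice, and `a ⊔ ⨅ C = ⨅ c ∈ C, a ⊔ c` for every
element `a` and every linearly ordered subset `C`. -/
structure IsLowerContinuous (α : Type*) [PartialOrder α] : Prop where
  complete : IsCompleteOrder α
  sup_inf : ∀ (a : α) (C : Set α), IsChain (· ≤ ·) C →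
    ∀ t j : α, IsGLB C t → IsLUB {a, t} j → IsGLB {x | ∃ c ∈ C, IsLUB {a, c} x} j

/-- `R` is injective as a right module over itself; right `R`-modules are modules over `Rᵐᵒᵖ`. -/
def IsRightSelfInjective (R : Type u) [Ring R] : Prop :=
  Module.Injective Rᵐᵒᵖ R

/-- `R` is injective as a left module over itself. -/
def IsLeftSelfInjective (R : Type u) [Ring R] : Prop :=
  Module.Injective R R

/-- For every index set `I`, finitely generated left submodules of `R^I` are finitely presented. -/
def IsLeftPiCoherent (R : Type u) [Ring R] : Prop :=
  ∀ (I : Type v) (N : Submodule R (I → R)), N.FG → Module.FinitePresentation R N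

/-- For every index set `I`, finitely generated right submodules of `R^I` are finitely presented. -/
def IsRightPiCoherent (R : Type u) [Ring R] : Prop :=
  ∀ (I : Type v) (N : Submodule Rᵐᵒᵖ (I → R)), N.FG → Module.FinitePresentation Rᵐᵒᵖ N

/-!
Over a von Neumann regular ring `R`, the finitely generated submodules of `R ^ n` are direct
summands and are closed under finite intersections and under preimages by linear maps.

If `P = R ^ n` is injective, then every submodule `U` of `P` has a closure, the least finitely
generated submodule containing it: it is the image of a projection of `P` that is the identity on
`U` and kills a submodule maximal among those disjoint from `U`. This makes `L(P)` complete, and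
upper continuous because a submodule disjoint from `U` is disjoint from its closure.

Conversely, to extend a linear map `f` from an ideal of `R` to `R`, take the closure of its graph
in `L(R × R)`. Upper continuity of `L(R × R)` shows that the closure still meets `0 × R` only in
zero, so it is the graph of an extension. When `L(R × R)` is only complete but `L(R)` is upper
continuous, this works for injective `f`: for `j` in the domain and a linear form `ψ` with
`ψ j • j = j`, the map `f - ψ(·) • f j` has range disjoint from the span of `f j`, and if `(0, f j)`
lies in the closure of the graph, then `f j` lies in the closure of that range. A general `f` is
reduced to an injective one by splitting off the closure of its kernel.

Annihilators under the dot product exchange `L` of the left and of the right module `R ^ n`. For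
`π`-coherence, the kernel of a map from `R ^ n` to a power of `R` is an intersection of finitely
generated submodules, hence finitely generated if `L(R ^ n)` is complete.
-/

/-- A module is regular (in the sense of Zelmanowitz) if every `v` satisfies `φ v • v = v` for some
linear form `φ`. Over a von Neumann regular ring these include all finite free modules, and being
regular passes to submodules. -/
def IsRegularModule (A M : Type*) [Ring A] [AddCommGroup M] [Module A M] : Prop :=
  ∀ v : M, ∃ φ : M →ₗ[A] A, φ v • v = v

/-- An element of a lattice is essential if only `⊥` is disjoint from it. -/
def IsEssential {α : Type*} [PartialOrder α] [OrderBot α] (w : α) : Prop :=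
  ∀ y, Disjoint y w → y = ⊥

theorem exists_disjoint_isEssential_sup {α : Type*} [CompleteLattice α] [IsModularLattice α]
    [IsCompactlyGenerated α] (u : α) : ∃ c, Disjoint u c ∧ IsEssential (u ⊔ c) := by
  obtain ⟨c, hc⟩ := zorn_le₀ {c | Disjoint u c} fun C hC hchain =>
    ⟨sSup C, hchain.directedOn.disjoint_sSup_right.2 fun _ hx => hC hx, fun _ => le_sSup⟩
  refine ⟨c, hc.prop, fun y hy => ?_⟩
  have hyc : c ⊔ y ≤ c :=
    hc.le_of_ge (hc.prop.disjoint_sup_right_of_disjoint_sup_left hy.symm) le_sup_left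
  exact le_bot_iff.1 (hy le_rfl ((le_sup_right.trans hyc).trans le_sup_right))

theorem submodule_chain_induction {A M : Type*} [Ring A] [AddCommGroup M] [Module A M]
    {motive : Submodule A M → Prop}
    (sSup_chain : ∀ c, IsChain (· ≤ ·) c → (∀ K ∈ c, motive K) → motive (sSup c))
    (sup_span : ∀ K x, motive K → motive (K ⊔ A ∙ x)) (U : Submodule A M) : motive U := by
  obtain ⟨K, ⟨hKU, hK⟩, hmax⟩ := zorn_le₀ {K | K ≤ U ∧ motive K} fun c hc hchain =>
    ⟨sSup c, ⟨sSup_le fun K hK => (hc hK).1, sSup_chain c hchain fun K hK => (hc hK).2⟩,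
      fun _ => le_sSup⟩
  have hUK : U ≤ K := fun x hx =>
    hmax ⟨sup_le hKU ((Submodule.span_singleton_le_iff_mem x U).2 hx), sup_span K x hK⟩ le_sup_left
      (Submodule.mem_sup_right (Submodule.mem_span_singleton_self x))
  exact le_antisymm hUK hKU ▸ hK

section Regular

variable {A M P : Type*} [Ring A] [AddCommGroup M] [Module A M] [AddCommGroup P] [Module A P]

theorem IsVNRegular.op {R : Type*} [Ring R] (hR : IsVNRegular R) : IsVNRegular Rᵐᵒᵖ := by
  intro a
  obtain ⟨x, hx⟩ := hR a.unop
  exact ⟨.op x, MulOpposite.unop_injective ((mul_assoc a.unop x a.unop).symm.trans hx)⟩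

theorem IsVNRegular.isRegularModule (hA : IsVNRegular A) : IsRegularModule A A := by
  intro a
  obtain ⟨x, hx⟩ := hA a
  exact ⟨LinearMap.toSpanSingleton A A x, hx⟩

namespace IsRegularModule

theorem of_injective (hP : IsRegularModule A P) (i : M →ₗ[A] P) (hi : Function.Injective i) :
    IsRegularModule A M := by
  intro v
  obtain ⟨φ, hφ⟩ := hP (i v)
  exact ⟨φ ∘ₗ i, hi ((map_smul i _ v).trans hφ)⟩

theorem prod (hM : IsRegularModule A M) (hP : IsRegularModule A P) :
    IsRegularModule A (M × P) := by
  rintro ⟨v, w⟩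
  obtain ⟨φ, hφ⟩ := hM v
  obtain ⟨ψ, hψ⟩ := hP (w - φ v • w)
  refine ⟨φ ∘ₗ LinearMap.fst A M P + LinearMap.toSpanSingleton A A (1 - φ v) ∘ₗ ψ ∘ₗ
    (LinearMap.snd A M P - LinearMap.toSpanSingleton A P w ∘ₗ φ ∘ₗ LinearMap.fst A M P), ?_⟩
  have hv : (1 - φ v) • v = 0 := by rw [sub_smul, one_smul, hφ, sub_self]
  have hw : (1 - φ v) • w = w - φ v • w := by rw [sub_smul, one_smul]
  ext
  · simp [add_smul, mul_smul, hv, hφ]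
  · simp only [LinearMap.add_apply, LinearMap.comp_apply, LinearMap.sub_apply,
      LinearMap.fst_apply, LinearMap.snd_apply, LinearMap.toSpanSingleton_apply, smul_eq_mul,
      Prod.snd_add, Prod.smul_snd, add_smul, mul_smul, hw, hψ, add_sub_cancel]

theorem pi_const {ι : Type*} [Finite ι] (hM : IsRegularModule A M) :
    IsRegularModule A (ι → M) := by
  induction ι using Finite.induction_empty_option with
  | of_equiv e ih =>
    exact ih.of_injective (LinearMap.funLeft A M e) (LinearEquiv.funCongrLeft A M e).injective
  | h_empty => exact fun v => ⟨0, Subsingleton.elim _ _⟩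
  | h_option ih =>
    refine (hM.prod ih).of_injective ((LinearMap.proj none).prod (LinearMap.funLeft A M some))
      fun x y hxy => funext fun i => ?_
    obtain ⟨hnone, hsome⟩ := Prod.ext_iff.1 hxy
    cases i with
    | none => exact hnone
    | some i => exact congrFun hsome i

theorem exists_quasiInverse_on (hP : IsRegularModule A P) (g : M →ₗ[A] P) {N : Submodule A M}
    (hN : N.FG) : ∃ s : P →ₗ[A] M, (∀ y, s y ∈ N) ∧ ∀ x ∈ N, g (s (g x)) = g x := by
  induction N, hN using Submodule.fg_sup_span_induction with
  | bot => exact ⟨0, by simp, by simp⟩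
  | sup N v _ ih =>
    obtain ⟨s, hsN, hs⟩ := ih
    let u := v - s (g v)
    obtain ⟨φ, hφ⟩ := hP (g u)
    refine ⟨s + LinearMap.toSpanSingleton A M u ∘ₗ φ ∘ₗ (LinearMap.id - g ∘ₗ s),
      fun y => ?_, fun x hx => ?_⟩
    · have hu : u ∈ N ⊔ A ∙ v := sub_mem
        (Submodule.mem_sup_right (Submodule.mem_span_singleton_self v))
        (Submodule.mem_sup_left (hsN _))
      exact add_mem (Submodule.mem_sup_left (hsN y)) (Submodule.smul_mem _ _ hu)
    · obtain ⟨y, hy, z, hz, rfl⟩ := Submodule.mem_sup.1 hx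
      obtain ⟨r, rfl⟩ := Submodule.mem_span_singleton.1 hz
      have hres : g (y + r • v) - g (s (g (y + r • v))) = r • g u := by
        simp only [u, map_add, map_smul, map_sub, hs y hy, smul_sub]
        abel
      simp only [LinearMap.add_apply, LinearMap.comp_apply, LinearMap.sub_apply, LinearMap.id_apply,
        LinearMap.toSpanSingleton_apply, map_add g (s _), map_smul, hres, smul_eq_mul, mul_smul, hφ]
      rw [← hres, add_sub_cancel]

theorem exists_proj (hM : IsRegularModule A M) {N : Submodule A M} (hN : N.FG) :
    ∃ p : M →ₗ[A] M, (∀ x, p x ∈ N) ∧ ∀ x ∈ N, p x = x :=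
  hM.exists_quasiInverse_on LinearMap.id hN

theorem fg_inf_ker (hP : IsRegularModule A P) (g : M →ₗ[A] P) {N : Submodule A M} (hN : N.FG) :
    (N ⊓ LinearMap.ker g).FG := by
  obtain ⟨s, hsN, hs⟩ := hP.exists_quasiInverse_on g hN
  suffices N ⊓ LinearMap.ker g = N.map (LinearMap.id - s ∘ₗ g) from this ▸ hN.map _
  refine le_antisymm ?_ ?_
  · rintro x ⟨hxN, hgx⟩
    exact ⟨x, hxN, by simp [LinearMap.mem_ker.1 hgx]⟩
  · rintro _ ⟨x, hx, rfl⟩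
    exact ⟨sub_mem hx (hsN _), by simp [hs x hx]⟩

theorem fg_comap [Module.Finite A M] (hP : IsRegularModule A P) (g : M →ₗ[A] P)
    {N : Submodule A P} (hN : N.FG) : (N.comap g).FG := by
  obtain ⟨p, hpN, hp⟩ := hP.exists_proj hN
  suffices N.comap g = ⊤ ⊓ LinearMap.ker ((LinearMap.id - p) ∘ₗ g) from
    this ▸ hP.fg_inf_ker _ Module.Finite.fg_top
  ext x
  simp only [Submodule.mem_comap, top_inf_eq, LinearMap.mem_ker, LinearMap.comp_apply,
    LinearMap.sub_apply, LinearMap.id_apply, sub_eq_zero]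
  exact ⟨fun hx => (hp _ hx).symm, fun hx => hx ▸ hpN _⟩

theorem fg_inf (hM : IsRegularModule A M) {N K : Submodule A M} (hN : N.FG) (hK : K.FG) :
    (N ⊓ K).FG := by
  have := Module.Finite.iff_fg.2 hN
  rw [← Submodule.map_comap_subtype]
  exact (hM.fg_comap N.subtype hK).map _

theorem exists_fg_relative_compl (hM : IsRegularModule A M) {N K : Submodule A M} (hN : N.FG)
    (hK : K.FG) : ∃ Y ≤ N, Y.FG ∧ Disjoint Y K ∧ N ≤ K ⊔ Y := by
  obtain ⟨p, hpNK, hp⟩ := hM.exists_proj (hM.fg_inf hN hK)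
  refine ⟨N.map (LinearMap.id - p), ?_, hN.map _, Submodule.disjoint_def.2 ?_, fun x hx => ?_⟩
  · rintro _ ⟨x, hx, rfl⟩
    exact sub_mem hx (hpNK x).1
  · rintro _ ⟨x, hx, rfl⟩ hxK
    have := hp _ ⟨sub_mem hx (hpNK x).1, hxK⟩
    simpa [hp _ (hpNK x)] using this.symm
  · exact Submodule.mem_sup.2 ⟨p x, (hpNK x).2, x - p x, ⟨x, hx, rfl⟩, add_sub_cancel _ _⟩

theorem exists_proj_of_disjoint (hM : IsRegularModule A M) {N K : Submodule A M} (hN : N.FG)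
    (hK : K.FG) (hNK : Disjoint N K) :
    ∃ p : M →ₗ[A] M, (∀ x ∈ N, p x = x) ∧ ∀ x ∈ K, p x = 0 := by
  obtain ⟨k, hkK, hk⟩ := hM.exists_proj hK
  obtain ⟨s, hsN, hs⟩ := hM.exists_quasiInverse_on (LinearMap.id - k : M →ₗ[A] M) hN
  refine ⟨s ∘ₗ (LinearMap.id - k), fun x hx => ?_, fun x hx => by simp [hk x hx]⟩
  have hker : k (s (x - k x) - x) = s (x - k x) - x := by
    have := hs x hx
    simp only [LinearMap.sub_apply, LinearMap.id_apply] at this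
    rw [map_sub, sub_eq_sub_iff_sub_eq_sub, ← neg_sub, this, neg_sub]
  exact sub_eq_zero.1 <| Submodule.disjoint_def.1 hNK _ (sub_mem (hsN _) hx) (hker ▸ hkK _)

theorem eq_zero_of_isEssential (hP : IsRegularModule A P) (d : M →ₗ[A] P) {W : Submodule A M}
    (hW : IsEssential W) (hd : ∀ x ∈ W, d x = 0) : d = 0 := by
  ext x
  obtain ⟨φ, hφ⟩ := hP (d x)
  -- `d` is injective on multiples of `φ (d x) • x`, so these meet `W` only in zero.
  have hspan : A ∙ (φ (d x) • x) = ⊥ := by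
    refine hW _ (Submodule.disjoint_def.2 fun y hy hyW => ?_)
    obtain ⟨r, rfl⟩ := Submodule.mem_span_singleton.1 hy
    have hr : r • d x = 0 := by simpa only [map_smul, hφ] using hd _ hyW
    rw [← mul_smul, ← smul_eq_mul r, ← map_smul, hr, map_zero, zero_smul]
  rw [← hφ, ← map_smul, Submodule.span_singleton_eq_bot.1 hspan, map_zero, LinearMap.zero_apply]

end IsRegularModule

end Regular

section Closure

variable {A M P : Type*} [Ring A] [AddCommGroup M] [Module A M] [AddCommGroup P] [Module A P]

/-- The intersection of all finitely generated submodules containing `U`. When it is itself finitely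
generated it is the least element of `L(M)` above `U`, so that in a complete `L(M)` the join of a
family is the closure of its sum. -/
def fgClosure (U : Submodule A M) : Submodule A M := sInf {N | N.FG ∧ U ≤ N}

theorem le_fgClosure (U : Submodule A M) : U ≤ fgClosure U := le_sInf fun _ hN => hN.2

theorem fgClosure_le {U N : Submodule A M} (hN : N.FG) (hUN : U ≤ N) : fgClosure U ≤ N :=
  sInf_le ⟨hN, hUN⟩

theorem fgClosure_mono {U V : Submodule A M} (hUV : U ≤ V) : fgClosure U ≤ fgClosure V :=
  sInf_le_sInf fun _ hN => ⟨hN.1, hUV.trans hN.2⟩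

theorem IsRegularModule.map_fgClosure_le [Module.Finite A M] (hP : IsRegularModule A P)
    (g : M →ₗ[A] P) (U : Submodule A M) : (fgClosure U).map g ≤ fgClosure (U.map g) :=
  le_sInf fun _ hN => Submodule.map_le_iff_le_comap.2 <|
    fgClosure_le (hP.fg_comap g hN.1) (Submodule.map_le_iff_le_comap.1 hN.2)

end Closure

section Order

variable {α β : Type*} [PartialOrder α] [PartialOrder β]

theorem IsCompleteOrder.congr (e : α ≃o β) (h : IsCompleteOrder α) : IsCompleteOrder β := by
  intro S
  obtain ⟨⟨s, hs⟩, t, ht⟩ := h (e.symm '' S)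
  exact ⟨⟨e s, e.symm.isLUB_image.1 hs⟩, e t, e.symm.isGLB_image.1 ht⟩

theorem isCompleteOrder_congr (e : α ≃o β) : IsCompleteOrder α ↔ IsCompleteOrder β :=
  ⟨.congr e, .congr e.symm⟩

theorem isCompleteOrder_orderDual : IsCompleteOrder αᵒᵈ ↔ IsCompleteOrder α :=
  ⟨fun h S => (h (OrderDual.ofDual ⁻¹' S)).symm, fun h S => (h (OrderDual.toDual ⁻¹' S)).symm⟩

theorem IsUpperContinuous.congr (e : α ≃o β) (h : IsUpperContinuous α) : IsUpperContinuous β where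
  complete := h.complete.congr e
  inf_sup a C hC s m hs hm := by
    have key := h.inf_sup (e.symm a) (e.symm '' C) (e.symm.monotone.isChain_image hC) (e.symm s)
      (e.symm m) (e.symm.isLUB_image'.2 hs) (by
        rw [← Set.image_pair]; exact e.symm.isGLB_image'.2 hm)
    rw [← e.symm.isLUB_image']
    convert key using 1
    ext x
    constructor
    · rintro ⟨_, ⟨c, hc, hx⟩, rfl⟩
      exact ⟨_, Set.mem_image_of_mem _ hc, by rw [← Set.image_pair]; exact e.symm.isGLB_image'.2 hx⟩
    · rintro ⟨_, ⟨c, hc, rfl⟩, hx⟩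
      rw [← Set.image_pair, e.symm.isGLB_image] at hx
      exact ⟨e x, ⟨c, hc, hx⟩, e.symm_apply_apply x⟩

theorem isUpperContinuous_congr (e : α ≃o β) : IsUpperContinuous α ↔ IsUpperContinuous β :=
  ⟨.congr e, .congr e.symm⟩

theorem isUpperContinuous_orderDual : IsUpperContinuous αᵒᵈ ↔ IsLowerContinuous α :=
  ⟨fun h => ⟨isCompleteOrder_orderDual.1 h.complete, fun a C hC =>
      h.inf_sup (OrderDual.toDual a) (OrderDual.ofDual ⁻¹' C) hC.symm⟩,
    fun h => ⟨isCompleteOrder_orderDual.2 h.complete, fun a C hC =>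
      h.sup_inf (OrderDual.ofDual a) (OrderDual.toDual ⁻¹' C) hC.symm⟩⟩

theorem isCompleteOrder_iff_of_dual (e : α ≃o βᵒᵈ) : IsCompleteOrder α ↔ IsCompleteOrder β :=
  (isCompleteOrder_congr e).trans isCompleteOrder_orderDual

theorem isUpperContinuous_iff_of_dual (e : α ≃o βᵒᵈ) : IsUpperContinuous α ↔ IsLowerContinuous β :=
  (isUpperContinuous_congr e).trans isUpperContinuous_orderDual

end Order

section Lattice

variable {A M P : Type*} [Ring A] [AddCommGroup M] [Module A M] [AddCommGroup P] [Module A P]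

/-- The isomorphism `L(M) ≃ L(P)` induced by a linear equivalence `M ≃ P`. -/
def FGLattice.congr (e : M ≃ₗ[A] P) : FGLattice A M ≃o FGLattice A P where
  toFun N := ⟨N.1.map (e : M →ₗ[A] P), N.2.map _⟩
  invFun N := ⟨N.1.map (e.symm : P →ₗ[A] M), N.2.map _⟩
  left_inv N := Subtype.ext <| by simp [← Submodule.map_comp]
  right_inv N := Subtype.ext <| by simp [← Submodule.map_comp]
  map_rel_iff' := Submodule.map_le_map_iff_of_injective e.injective _ _

theorem IsCompleteOrder.fg_sInf (h : IsCompleteOrder (FGLattice A M)) {S : Set (Submodule A M)}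
    (hS : ∀ N ∈ S, N.FG) : (sInf S).FG := by
  obtain ⟨t, ht⟩ := (h (Subtype.val ⁻¹' S)).2
  suffices sInf S = t.1 from this ▸ t.2
  refine le_antisymm (fun x hx => ?_) (le_sInf fun N hN =>
    ht.1 (show (⟨N, hS N hN⟩ : FGLattice A M) ∈ Subtype.val ⁻¹' S from hN))
  have hspan : (⟨A ∙ x, Submodule.fg_span_singleton x⟩ : FGLattice A M) ≤ t :=
    ht.2 fun N hN => Subtype.coe_le_coe.1 <|
      (Submodule.span_singleton_le_iff_mem x N.1).2 (Submodule.mem_sInf.1 hx N hN)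
  exact hspan (Submodule.mem_span_singleton_self x)

theorem IsCompleteOrder.fg_fgClosure (h : IsCompleteOrder (FGLattice A M)) (U : Submodule A M) :
    (fgClosure U).FG :=
  h.fg_sInf fun _ hN => hN.1

theorem isCompleteOrder_of_fg_fgClosure (h : ∀ U : Submodule A M, (fgClosure U).FG) :
    IsCompleteOrder (FGLattice A M) := by
  refine fun S => ⟨⟨⟨_, h (sSup (Subtype.val '' S))⟩, fun N hN => ?_, fun N hN => ?_⟩,
    ⟨_, h (sInf (Subtype.val '' S))⟩, fun N hN => ?_, fun N hN => ?_⟩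
  · exact Subtype.coe_le_coe.1 ((le_sSup (Set.mem_image_of_mem _ hN)).trans (le_fgClosure _))
  · exact Subtype.coe_le_coe.1 (fgClosure_le N.2 (sSup_le (Set.forall_mem_image.2 fun _ => (hN ·))))
  · exact Subtype.coe_le_coe.1 (fgClosure_le N.2 (sInf_le (Set.mem_image_of_mem _ hN)))
  · exact Subtype.coe_le_coe.1 <|
      (le_sInf (Set.forall_mem_image.2 fun _ => (hN ·))).trans (le_fgClosure _)

namespace IsRegularModule

theorem isGLB_pair_iff (hM : IsRegularModule A M) {a b m : FGLattice A M} :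
    IsGLB {a, b} m ↔ m.1 = a.1 ⊓ b.1 := by
  have hab : IsGLB {a, b} (⟨a.1 ⊓ b.1, hM.fg_inf a.2 b.2⟩ : FGLattice A M) := by
    refine ⟨?_, fun N hN => ?_⟩
    · rintro _ (rfl | rfl)
      · exact Subtype.coe_le_coe.1 inf_le_left
      · exact Subtype.coe_le_coe.1 inf_le_right
    · exact Subtype.coe_le_coe.1 (le_inf (hN (.inl rfl)) (hN (.inr rfl)))
  refine ⟨fun h => congrArg Subtype.val (h.unique hab), fun h => ?_⟩
  rwa [show m = ⟨a.1 ⊓ b.1, hM.fg_inf a.2 b.2⟩ from Subtype.ext h]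

theorem isUpperContinuous_of_disjoint_fgClosure (hM : IsRegularModule A M)
    (hcomplete : IsCompleteOrder (FGLattice A M))
    (hdisj : ∀ N U : Submodule A M, N.FG → Disjoint N U → Disjoint N (fgClosure U)) :
    IsUpperContinuous (FGLattice A M) := by
  refine ⟨hcomplete, fun a C hC s m hs hm => ?_⟩
  simp only [hM.isGLB_pair_iff] at hm ⊢
  refine ⟨fun x ⟨c, hc, hx⟩ => ?_, fun t ht => ?_⟩
  · exact Subtype.coe_le_coe.1 (hx ▸ hm ▸ inf_le_inf_left a.1 (hs.1 hc))
  -- A complement `Y` of `t` in `a ⊓ s` is disjoint from every `c ∈ C`, hence from `s`.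
  obtain ⟨Y, hYm, hY, hYt, hmtY⟩ := hM.exists_fg_relative_compl m.2 t.2
  have hYC : Disjoint Y (sSup (Subtype.val '' C)) := by
    refine ((Subtype.mono_coe _).isChain_image hC).directedOn.disjoint_sSup_right.2 ?_
    rintro _ ⟨c, hc, rfl⟩
    refine disjoint_iff_inf_le.2 (le_trans (le_inf inf_le_left ?_) hYt.le_bot)
    have hact : (⟨a.1 ⊓ c.1, hM.fg_inf a.2 c.2⟩ : FGLattice A M) ≤ t := ht ⟨c, hc, rfl⟩
    exact (inf_le_inf_right c.1 (hYm.trans (hm.trans_le inf_le_left))).trans hact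
  have hsC : s ≤ ⟨fgClosure (sSup (Subtype.val '' C)), hcomplete.fg_fgClosure _⟩ :=
    hs.2 fun c hc =>
      (le_sSup (Set.mem_image_of_mem _ hc)).trans (le_fgClosure _)
  have hYbot : Y = ⊥ := le_bot_iff.1 <|
    hdisj Y _ hY hYC le_rfl (hYm.trans ((hm.trans_le inf_le_right).trans hsC))
  exact Subtype.coe_le_coe.1 (hmtY.trans_eq (by rw [hYbot, sup_bot_eq]))

theorem disjoint_fgClosure_sSup (hM : IsRegularModule A M) (h : IsUpperContinuous (FGLattice A M))
    {c : Set (Submodule A M)} (hc : IsChain (· ≤ ·) c) {N : Submodule A M} (hN : N.FG)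
    (hNc : ∀ K ∈ c, Disjoint N (fgClosure K)) : Disjoint N (fgClosure (sSup c)) := by
  let f (K : Submodule A M) : FGLattice A M := ⟨fgClosure K, h.complete.fg_fgClosure K⟩
  have hf : Monotone f := fun K L hKL => fgClosure_mono hKL
  have hsup : IsLUB (f '' c) (f (sSup c)) := by
    refine ⟨Set.forall_mem_image.2 fun K hK => hf (le_sSup hK), fun L hL => ?_⟩
    exact fgClosure_le L.2 <| sSup_le fun K hK =>
      (le_fgClosure K).trans (hL (Set.mem_image_of_mem f hK))
  have hbot : _ ≤ (⟨⊥, Submodule.fg_bot⟩ : FGLattice A M) :=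
    (h.inf_sup ⟨N, hN⟩ _ (hf.isChain_image hc) _ ⟨_, hM.fg_inf hN (f (sSup c)).2⟩ hsup
      (hM.isGLB_pair_iff.2 rfl)).2 <| by
      rintro x ⟨_, ⟨K, hK, rfl⟩, hx⟩
      exact Subtype.coe_le_coe.1 ((hM.isGLB_pair_iff.1 hx).trans_le (hNc K hK).le_bot)
  exact disjoint_iff_inf_le.2 hbot

theorem disjoint_fgClosure_sup (hM : IsRegularModule A M) {K L N : Submodule A M}
    (hK : (fgClosure K).FG) (hL : L.FG) (hN : N.FG)
    (hdisj : ∀ a : Submodule A M, a.FG → Disjoint a K → Disjoint a (fgClosure K))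
    (hNKL : Disjoint N (K ⊔ L)) : Disjoint N (fgClosure (K ⊔ L)) := by
  -- Replacing `L` by a complement `Y` of `fgClosure K` in it, the three summands are independent.
  obtain ⟨Y, hYL, hY, hYK, hLY⟩ := hM.exists_fg_relative_compl hL hK
  have hKY : Disjoint K Y := (hYK.mono_right (le_fgClosure K)).symm
  have hNY : Disjoint (Y ⊔ N) (fgClosure K) := by
    refine hdisj _ (hY.sup hN) ?_
    exact (hKY.disjoint_sup_right_of_disjoint_sup_left
      (hNKL.symm.mono_left (sup_le_sup_left hYL K))).symm
  have hNYK : Disjoint N (Y ⊔ fgClosure K) := by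
    refine Disjoint.disjoint_sup_right_of_disjoint_sup_left ?_ (sup_comm Y N ▸ hNY)
    exact hNKL.mono_right (hYL.trans le_sup_right)
  refine hNYK.mono_right (fgClosure_le (hY.sup hK) (sup_le ?_ (sup_comm Y _ ▸ hLY)))
  exact (le_fgClosure K).trans le_sup_right

theorem disjoint_fgClosure (hM : IsRegularModule A M) (h : IsUpperContinuous (FGLattice A M))
    {U V : Submodule A M} (hUV : Disjoint U V) : Disjoint U (fgClosure V) := by
  suffices hFG : ∀ N : Submodule A M, N.FG → Disjoint N V → Disjoint N (fgClosure V) by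
    refine Submodule.disjoint_def.2 fun x hxU hxV => ?_
    have hx := hFG _ (Submodule.fg_span_singleton x)
      (hUV.mono_left ((Submodule.span_singleton_le_iff_mem x U).2 hxU))
    exact Submodule.disjoint_def.1 hx x (Submodule.mem_span_singleton_self x) hxV
  clear hUV
  induction V using submodule_chain_induction with
  | sSup_chain c hc ih =>
    exact fun N hN hNc => hM.disjoint_fgClosure_sSup h hc hN fun K hK =>
      ih K hK N hN (hNc.mono_right (le_sSup hK))
  | sup_span K x ih =>
    exact fun N hN => hM.disjoint_fgClosure_sup (h.complete.fg_fgClosure K)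
      (Submodule.fg_span_singleton x) hN ih

theorem disjoint_fgClosure_fgClosure (hM : IsRegularModule A M)
    (h : IsUpperContinuous (FGLattice A M)) {U V : Submodule A M} (hUV : Disjoint U V) :
    Disjoint (fgClosure U) (fgClosure V) :=
  (hM.disjoint_fgClosure h (hM.disjoint_fgClosure h hUV).symm).symm

end IsRegularModule

end Lattice

section Injective

variable {A : Type u} [Ring A] [Small.{v} A] {Q : Type v} [AddCommGroup Q] [Module A Q]
  [Module.Injective A Q]

theorem exists_proj_of_disjoint_of_injective {U C : Submodule A Q} (hUC : Disjoint U C) :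
    ∃ p : Q →ₗ[A] Q, (∀ x ∈ U, p x = x) ∧ ∀ x ∈ C, p x = 0 := by
  have hinj : Function.Injective (U.subtype.coprod C.subtype) := by
    rw [← LinearMap.ker_eq_bot, LinearMap.ker_coprod_of_disjoint_range] <;> simp [hUC]
  obtain ⟨p, hp⟩ := Module.Injective.extension_property A Q (U × C) Q _ hinj
    (U.subtype ∘ₗ LinearMap.fst A U C)
  refine ⟨p, fun x hx => ?_, fun x hx => ?_⟩
  · simpa using LinearMap.congr_fun hp (⟨x, hx⟩, 0)
  · simpa using LinearMap.congr_fun hp (0, ⟨x, hx⟩)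

variable [Module.Finite A Q]

theorem IsRegularModule.fg_fgClosure_of_injective (hQ : IsRegularModule A Q)
    (U : Submodule A Q) : (fgClosure U).FG := by
  obtain ⟨C, hUC, hess⟩ := exists_disjoint_isEssential_sup U
  obtain ⟨p, hpU, hpC⟩ := exists_proj_of_disjoint_of_injective hUC
  suffices fgClosure U = LinearMap.range p from this ▸ Submodule.fg_range p
  refine le_antisymm (fgClosure_le (Submodule.fg_range p) fun x hx => ⟨x, hpU x hx⟩) ?_
  refine le_sInf fun N ⟨hN, hUN⟩ => ?_
  obtain ⟨q, hqN, hq⟩ := hQ.exists_proj hN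
  have hqp : p - q ∘ₗ p = 0 := by
    refine hQ.eq_zero_of_isEssential _ hess fun x hx => ?_
    obtain ⟨y, hy, z, hz, rfl⟩ := Submodule.mem_sup.1 hx
    simp [hpU y hy, hpC z hz, hq y (hUN hy)]
  rintro _ ⟨x, rfl⟩
  rw [sub_eq_zero.1 (LinearMap.congr_fun hqp x)]
  exact hqN _

theorem IsRegularModule.disjoint_fgClosure_of_injective (hQ : IsRegularModule A Q)
    {N U : Submodule A Q} (hNU : Disjoint N U) : Disjoint N (fgClosure U) := by
  obtain ⟨p, hpU, hpN⟩ := exists_proj_of_disjoint_of_injective hNU.symm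
  have hle : fgClosure U ≤ LinearMap.ker (p - LinearMap.id) :=
    fgClosure_le (hQ.fg_comap _ Submodule.fg_bot) fun x hx => by simp [hpU x hx]
  refine Submodule.disjoint_def.2 fun x hxN hxU => ?_
  exact (sub_eq_zero.1 (hle hxU)).symm.trans (hpN x hxN)

theorem IsRegularModule.isUpperContinuous_of_injective (hQ : IsRegularModule A Q) :
    IsUpperContinuous (FGLattice A Q) :=
  hQ.isUpperContinuous_of_disjoint_fgClosure
    (isCompleteOrder_of_fg_fgClosure hQ.fg_fgClosure_of_injective)
    fun _ _ _ => hQ.disjoint_fgClosure_of_injective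

end Injective

section RelativelyInjective

variable {A M P : Type*} [Ring A] [AddCommGroup M] [Module A M] [AddCommGroup P] [Module A P]

/-- `P` is injective relative to `M`: every linear map to `P` from a submodule of `M` extends to
`M`. Baer's criterion is the case `M = A`. -/
def IsRelativelyInjective (A M P : Type*) [Ring A] [AddCommGroup M] [Module A M] [AddCommGroup P]
    [Module A P] : Prop :=
  ∀ f : M →ₗ.[A] P, ∃ h : M →ₗ[A] P, ∀ x : f.domain, h x = f x

theorem IsRelativelyInjective.baer (h : IsRelativelyInjective A M P) (i : A →ₗ[A] M)
    (hi : Function.Injective i) : Module.Baer A P := by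
  intro J g
  let e := Submodule.equivMapOfInjective i hi J
  obtain ⟨k, hk⟩ := h ⟨Submodule.map i J, g ∘ₗ e.symm⟩
  refine ⟨k ∘ₗ i, fun x hx => (hk (e ⟨x, hx⟩)).trans ?_⟩
  exact congrArg g (e.symm_apply_apply ⟨x, hx⟩)

namespace IsRegularModule

theorem exists_extension_of_fgClosure_graph (hM : IsRegularModule A M) (f : M →ₗ.[A] P)
    (hf : (fgClosure f.graph).FG) (hzero : ∀ t, (0, t) ∈ fgClosure f.graph → t = 0) :
    ∃ h : M →ₗ[A] P, ∀ x : f.domain, h x = f x := by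
  obtain ⟨s, hsN, hs⟩ := hM.exists_quasiInverse_on (LinearMap.fst A M P) hf
  refine ⟨LinearMap.snd A M P ∘ₗ s, fun x => ?_⟩
  have hx : (x.1, f x) ∈ fgClosure f.graph := le_fgClosure _ (f.mem_graph x)
  refine sub_eq_zero.1 (hzero _ ?_)
  have hfst : (s x).1 - x = 0 := sub_eq_zero.2 (hs _ hx)
  exact hfst ▸ sub_mem (hsN x.1) hx

theorem isRelativelyInjective_of_prod (hM : IsRegularModule A M)
    (hP : IsRegularModule A P) (h : IsUpperContinuous (FGLattice A (M × P))) :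
    IsRelativelyInjective A M P := by
  intro f
  refine hM.exists_extension_of_fgClosure_graph f (h.complete.fg_fgClosure _) fun t ht => ?_
  have hdisj : Disjoint (LinearMap.range (LinearMap.inr A M P)) f.graph := by
    refine Submodule.disjoint_def.2 ?_
    rintro _ ⟨t, rfl⟩ ht
    exact congrArg (Prod.mk 0) (f.graph_fst_eq_zero_snd ht rfl)
  have := Submodule.disjoint_def.1 ((hM.prod hP).disjoint_fgClosure h hdisj) _ ⟨t, rfl⟩ ht
  exact congrArg Prod.snd this

variable [Module.Finite A M] [Module.Finite A P]

theorem sub_mem_fgClosure_range (hP : IsRegularModule A P) (f : M →ₗ.[A] P) (h : M →ₗ[A] P)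
    {x : M × P} (hx : x ∈ fgClosure f.graph) :
    x.2 - h x.1 ∈ fgClosure (LinearMap.range (f.toFun - h ∘ₗ f.domain.subtype)) := by
  let g := LinearMap.snd A M P - h ∘ₗ LinearMap.fst A M P
  refine fgClosure_mono ?_ (hP.map_fgClosure_le g f.graph ⟨x, hx, rfl⟩)
  rintro _ ⟨y, hy, rfl⟩
  obtain ⟨z, rfl⟩ := f.mem_graph_iff'.1 hy
  exact ⟨z, rfl⟩

theorem eq_zero_of_mem_fgClosure_graph (hM : IsRegularModule A M) (hP : IsRegularModule A P)
    (h : IsUpperContinuous (FGLattice A P)) {f : M →ₗ.[A] P} (hf : Function.Injective f.toFun)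
    {j : f.domain} (hj : (0, f j) ∈ fgClosure f.graph) : f j = 0 := by
  obtain ⟨ψ, hψ⟩ := hM (j : M)
  let g := LinearMap.toSpanSingleton A P (f j) ∘ₗ ψ
  let V := LinearMap.range (f.toFun - g ∘ₗ f.domain.subtype)
  have hjV : f j ∈ fgClosure V := by
    simpa only [map_zero, sub_zero] using hP.sub_mem_fgClosure_range f g hj
  have hdisj : Disjoint (A ∙ f j) V := by
    refine Submodule.disjoint_def.2 ?_
    rintro _ hr ⟨x, rfl⟩
    obtain ⟨r, hr⟩ := Submodule.mem_span_singleton.1 hr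
    have hx : r • (j : M) = x - ψ x • (j : M) :=
      congrArg Subtype.val (hf (a₁ := r • j) (a₂ := x - ψ x • j) (by
        simpa [g, f.map_sub, f.map_smul] using hr))
    have hrj : r • (j : M) = 0 := by
      rw [← hψ, ← mul_smul, ← smul_eq_mul, ← map_smul, hx, map_sub, map_smul, sub_smul,
        smul_eq_mul, mul_smul, hψ, sub_self]
    have hrj' : r • j = 0 := Subtype.ext hrj
    rw [← hr, ← f.map_smul, hrj', f.map_zero]
  exact Submodule.disjoint_def.1 (hP.disjoint_fgClosure h hdisj) _
    (Submodule.mem_span_singleton_self _) hjV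

theorem exists_extension_of_injective (hM : IsRegularModule A M) (hP : IsRegularModule A P)
    (h : IsUpperContinuous (FGLattice A P)) (hprod : IsCompleteOrder (FGLattice A (M × P)))
    {f : M →ₗ.[A] P} (hf : Function.Injective f.toFun) :
    ∃ k : M →ₗ[A] P, ∀ x : f.domain, k x = f x := by
  have hG := hprod.fg_fgClosure f.graph
  let T : Submodule A P := (fgClosure f.graph).comap (LinearMap.inr A M P)
  have hTdisj : Disjoint T (LinearMap.range f.toFun) := by
    refine Submodule.disjoint_def.2 ?_
    rintro _ ht ⟨j, rfl⟩
    exact hM.eq_zero_of_mem_fgClosure_graph hP h hf ht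
  have hTle : T ≤ fgClosure (LinearMap.range f.toFun) := fun t ht => by
    simpa using hP.sub_mem_fgClosure_range f 0 ht
  have hT : T = ⊥ := le_bot_iff.1 (hP.disjoint_fgClosure h hTdisj le_rfl hTle)
  exact hM.exists_extension_of_fgClosure_graph f hG fun t ht =>
    (Submodule.mem_bot A).1 (hT ▸ Submodule.mem_comap.2 ht)

theorem isRelativelyInjective_of_complete (hM : IsRegularModule A M) (hP : IsRegularModule A P)
    (hUM : IsUpperContinuous (FGLattice A M)) (hUP : IsUpperContinuous (FGLattice A P))
    (hprod : IsCompleteOrder (FGLattice A (M × P))) : IsRelativelyInjective A M P := by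
  intro f
  obtain ⟨C, hKC, hess⟩ := exists_disjoint_isEssential_sup (LinearMap.ker f.toFun)
  let K' : Submodule A M := (LinearMap.ker f.toFun).map f.domain.subtype
  let C' : Submodule A M := C.map f.domain.subtype
  have hCK : Disjoint C' K' := (Submodule.disjoint_map f.domain.injective_subtype hKC).symm
  obtain ⟨p, hpC, hpK⟩ := hM.exists_proj_of_disjoint (hUM.complete.fg_fgClosure C')
    (hUM.complete.fg_fgClosure K') (hM.disjoint_fgClosure_fgClosure hUM hCK)
  let e := Submodule.equivMapOfInjective f.domain.subtype f.domain.injective_subtype C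
  obtain ⟨k, hk⟩ := hM.exists_extension_of_injective hP hUP hprod
    (f := ⟨C', f.toFun ∘ₗ C.subtype ∘ₗ e.symm⟩)
    ((LinearMap.injective_domRestrict_iff.2 hKC.symm).comp e.symm.injective)
  have hkC (x : f.domain) (hx : x ∈ C) : k x = f x :=
    (hk (e ⟨x, hx⟩)).trans (congrArg (f.toFun ∘ₗ C.subtype) (e.symm_apply_apply ⟨x, hx⟩))
  have hkp : (k ∘ₗ p) ∘ₗ f.domain.subtype - f.toFun = 0 := by
    refine hP.eq_zero_of_isEssential _ hess fun x hx => ?_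
    obtain ⟨y, hy, z, hz, rfl⟩ := Submodule.mem_sup.1 hx
    have hpy : p y = 0 := hpK _ (le_fgClosure K' ⟨y, hy, rfl⟩)
    have hpz : p z = z := hpC _ (le_fgClosure C' ⟨z, hz, rfl⟩)
    have hfy : f y = 0 := hy
    simp [f.map_add, hpy, hpz, hkC z hz, hfy]
  exact ⟨k ∘ₗ p, fun x => sub_eq_zero.1 (LinearMap.congr_fun hkp x)⟩

end IsRegularModule

end RelativelyInjective

theorem IsRegularModule.injective_tfae {A : Type u} {P : Type v} [Ring A] [AddCommGroup P]
    [Module A P] [Small.{v} A] [Module.Finite A P] (hP : IsRegularModule A P) (i : A →ₗ[A] P)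
    (hi : Function.Injective i) :
    List.TFAE
      [ Module.Injective A P,
        ∀ n : ℕ, IsUpperContinuous (FGLattice A (Fin n → P)),
        IsUpperContinuous (FGLattice A (Fin 2 → P)),
        IsUpperContinuous (FGLattice A P) ∧ IsCompleteOrder (FGLattice A (Fin 2 → P)) ] := by
  let e : FGLattice A (Fin 2 → P) ≃o FGLattice A (P × P) :=
    FGLattice.congr (LinearEquiv.finTwoArrow A P)
  tfae_have 1 → 2 := fun _ n => hP.pi_const.isUpperContinuous_of_injective
  tfae_have 2 → 3 := fun h => h 2
  tfae_have 3 → 1 := fun h =>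
    ((hP.isRelativelyInjective_of_prod hP (h.congr e)).baer i hi).injective
  tfae_have 1 → 4 := fun _ =>
    ⟨hP.isUpperContinuous_of_injective, hP.pi_const.isUpperContinuous_of_injective.complete⟩
  tfae_have 4 → 1 := fun ⟨h, hc⟩ =>
    ((hP.isRelativelyInjective_of_complete hP h h (hc.congr e)).baer i hi).injective
  tfae_finish

section Duality

section Pairing

variable {A S M N K : Type*} [Ring A] [Ring S] [AddCommGroup M] [Module A M] [AddCommGroup N]
  [Module S N] [AddCommGroup K] [Module A K] [Module S K] [SMulCommClass S A K]

/-- The annihilator in `N` of a submodule of `M` with respect to a pairing `B` of a left module `M`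
with a right module `N` (that is, a left module over `S = Aᵐᵒᵖ`; any pair of commuting actions on
the target will do). The annihilator of a submodule of `N` is taken with respect to `B.flip`. -/
def perp (B : M →ₗ[A] N →ₗ[S] K) (U : Submodule A M) : Submodule S N :=
  ⨅ u ∈ U, LinearMap.ker (B u)

theorem mem_perp {B : M →ₗ[A] N →ₗ[S] K} {U : Submodule A M} {y : N} :
    y ∈ perp B U ↔ ∀ u ∈ U, B u y = 0 := by
  simp only [perp, Submodule.mem_iInf, LinearMap.mem_ker]

theorem IsRegularModule.fg_perp [Module.Finite S N] (hK : IsRegularModule S K)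
    (B : M →ₗ[A] N →ₗ[S] K) {U : Submodule A M} (hU : U.FG) : (perp B U).FG := by
  induction U, hU using Submodule.fg_sup_span_induction with
  | bot =>
    suffices perp B ⊥ = ⊤ from this ▸ Module.Finite.fg_top
    exact eq_top_iff.2 fun y _ => mem_perp.2 fun u hu => by simp [(Submodule.mem_bot A).1 hu]
  | sup U v _ ih =>
    suffices perp B (U ⊔ A ∙ v) = perp B U ⊓ LinearMap.ker (B v) from
      this ▸ hK.fg_inf_ker (B v) ih
    ext y
    rw [Submodule.mem_inf, LinearMap.mem_ker]
    refine ⟨fun hy => ⟨mem_perp.2 fun u hu => mem_perp.1 hy u (Submodule.mem_sup_left hu),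
      mem_perp.1 hy v (Submodule.mem_sup_right (Submodule.mem_span_singleton_self v))⟩, ?_⟩
    rintro ⟨hyU, hyv⟩
    refine mem_perp.2 fun x hx => ?_
    obtain ⟨u, hu, w, hw, rfl⟩ := Submodule.mem_sup.1 hx
    obtain ⟨r, rfl⟩ := Submodule.mem_span_singleton.1 hw
    simp [mem_perp.1 hyU u hu, hyv]

attribute [local instance] SMulCommClass.symm

theorem le_perp_iff {B : M →ₗ[A] N →ₗ[S] K} {U : Submodule A M} {V : Submodule S N} :
    V ≤ perp B U ↔ U ≤ perp B.flip V :=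
  ⟨fun h u hu => mem_perp.2 fun _ hv => mem_perp.1 (h hv) u hu,
    fun h v hv => mem_perp.2 fun _ hu => mem_perp.1 (h hu) v hv⟩

theorem IsRegularModule.perp_perp (hM : IsRegularModule A M) {B : M →ₗ[A] N →ₗ[S] K}
    (hB : Function.Injective B) (hB' : Function.Surjective B.flip) {U : Submodule A M}
    (hU : U.FG) : perp B.flip (perp B U) = U := by
  refine le_antisymm (fun x hx => ?_) (le_perp_iff.1 le_rfl)
  obtain ⟨p, hpU, hp⟩ := hM.exists_proj hU
  suffices p x = x from this ▸ hpU x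
  refine hB (LinearMap.ext fun y => ?_)
  -- The linear form `B (p · - ·) y` vanishes on `U`, so it pairs with an element of `perp B U`.
  obtain ⟨z, hz⟩ := hB' (B.flip y ∘ₗ (p - LinearMap.id))
  have hzB (u : M) : B u z = B (p u) y - B u y := by
    simpa using LinearMap.congr_fun hz u
  have hzU : z ∈ perp B U := mem_perp.2 fun u hu => by rw [hzB, hp u hu, sub_self]
  exact sub_eq_zero.1 ((hzB x).symm.trans (mem_perp.1 hx z hzU))

/-- A perfect pairing induces an anti-isomorphism `L(M) ≃ L(N)`, which takes annihilators. -/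
def FGLattice.perpIso [Module.Finite A M] [Module.Finite S N] (hM : IsRegularModule A M)
    (hN : IsRegularModule S N) (hKA : IsRegularModule A K) (hKS : IsRegularModule S K)
    {B : M →ₗ[A] N →ₗ[S] K} (hB : Function.Bijective B) (hB' : Function.Bijective B.flip) :
    FGLattice A M ≃o (FGLattice S N)ᵒᵈ where
  toFun U := OrderDual.toDual ⟨perp B U.1, hKS.fg_perp B U.2⟩
  invFun V := ⟨perp B.flip (OrderDual.ofDual V).1, hKA.fg_perp B.flip (OrderDual.ofDual V).2⟩
  left_inv U := Subtype.ext (hM.perp_perp hB.1 hB'.2 U.2)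
  right_inv V := Subtype.ext (hN.perp_perp hB'.1 hB.2 (OrderDual.ofDual V).2)
  map_rel_iff' {U V} := by
    change perp B V.1 ≤ perp B U.1 ↔ U.1 ≤ V.1
    rw [le_perp_iff, hM.perp_perp hB.1 hB'.2 V.2]

end Pairing

variable {R ι : Type*} [Ring R] [Fintype ι]

theorem bijective_dotProductBilin :
    Function.Bijective (dotProductBilin R Rᵐᵒᵖ : (ι → R) →ₗ[R] (ι → R) →ₗ[Rᵐᵒᵖ] R) := by
  classical
  refine ⟨fun v w hvw => funext fun i => ?_, fun f => ⟨fun i => f (Pi.single i 1), ?_⟩⟩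
  · simpa using LinearMap.congr_fun hvw (Pi.single i 1)
  · refine LinearMap.pi_ext fun i x => ?_
    have hx : (Pi.single i x : ι → R) = MulOpposite.op x • Pi.single i 1 := by
      simp [← Pi.single_smul]
    rw [hx, map_smul, map_smul]
    simp

theorem bijective_flip_dotProductBilin :
    Function.Bijective (dotProductBilin R Rᵐᵒᵖ : (ι → R) →ₗ[R] (ι → R) →ₗ[Rᵐᵒᵖ] R).flip := by
  classical
  refine ⟨fun v w hvw => funext fun i => ?_, fun f => ⟨fun i => f (Pi.single i 1), ?_⟩⟩
  · simpa using LinearMap.congr_fun hvw (Pi.single i 1)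
  · exact LinearMap.pi_ext' fun i => LinearMap.ext_ring (by simp)

end Duality

theorem IsRegularModule.finitePresentation_of_fg_pi {A I : Type*} {Q : I → Type*} [Ring A]
    [∀ i, AddCommGroup (Q i)] [∀ i, Module A (Q i)] (hQ : ∀ i, IsRegularModule A (Q i))
    (h : ∀ n : ℕ, IsCompleteOrder (FGLattice A (Fin n → A))) {N : Submodule A (∀ i, Q i)}
    (hN : N.FG) : Module.FinitePresentation A N := by
  have := Module.Finite.iff_fg.2 hN
  obtain ⟨n, f, hf⟩ := Module.Finite.exists_fin' A N
  let g (i : I) : (Fin n → A) →ₗ[A] Q i := LinearMap.proj i ∘ₗ N.subtype ∘ₗ f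
  have hker : LinearMap.ker f = sInf (Set.range fun i => LinearMap.ker (g i)) := by
    ext x
    rw [sInf_range, Submodule.mem_iInf, LinearMap.mem_ker, ← Submodule.coe_eq_zero, funext_iff]
    rfl
  refine Module.finitePresentation_of_surjective f hf (hker ▸ (h n).fg_sInf ?_)
  exact Set.forall_mem_range.2 fun i => (hQ i).fg_comap (g i) Submodule.fg_bot

instance finite_mulOpposite_self {R : Type*} [Ring R] : Module.Finite Rᵐᵒᵖ R :=
  .equiv (MulOpposite.opLinearEquiv Rᵐᵒᵖ).symm

namespace IsVNRegular

variable {R : Type u} [Ring R]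

theorem isRegularModule_right (hR : IsVNRegular R) : IsRegularModule Rᵐᵒᵖ R :=
  hR.op.isRegularModule.of_injective (MulOpposite.opLinearEquiv Rᵐᵒᵖ).toLinearMap
    (MulOpposite.opLinearEquiv Rᵐᵒᵖ).injective

/-- The anti-isomorphism between the lattices of finitely generated left and right submodules of
`R^ι`, given by annihilators with respect to the dot product. -/
def fgLatticePiIso (hR : IsVNRegular R) (ι : Type*) [Fintype ι] :
    FGLattice R (ι → R) ≃o (FGLattice Rᵐᵒᵖ (ι → R))ᵒᵈ :=
  FGLattice.perpIso hR.isRegularModule.pi_const hR.isRegularModule_right.pi_const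
    hR.isRegularModule hR.isRegularModule_right bijective_dotProductBilin
    bijective_flip_dotProductBilin

/-- The anti-isomorphism between the lattices of finitely generated left and right ideals of `R`,
read off from `fgLatticePiIso` for a one-element index type. -/
def fgLatticeSelfIso (hR : IsVNRegular R) : FGLattice R R ≃o (FGLattice Rᵐᵒᵖ R)ᵒᵈ :=
  (FGLattice.congr (LinearEquiv.funUnique (Fin 1) R R)).symm.trans <|
    (hR.fgLatticePiIso (Fin 1)).trans (FGLattice.congr (LinearEquiv.funUnique (Fin 1) Rᵐᵒᵖ R)).dual

theorem isRightSelfInjective_tfae (hR : IsVNRegular R) :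
    List.TFAE
      [ IsRightSelfInjective R,
        ∀ n : ℕ, IsUpperContinuous (FGLattice Rᵐᵒᵖ (Fin n → R)),
        IsUpperContinuous (FGLattice Rᵐᵒᵖ (Fin 2 → R)),
        IsUpperContinuous (FGLattice Rᵐᵒᵖ R) ∧ IsCompleteOrder (FGLattice Rᵐᵒᵖ (Fin 2 → R)) ] :=
  hR.isRegularModule_right.injective_tfae (MulOpposite.opLinearEquiv Rᵐᵒᵖ).symm.toLinearMap
    (MulOpposite.opLinearEquiv Rᵐᵒᵖ).symm.injective

theorem isLeftSelfInjective_tfae (hR : IsVNRegular R) :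
    List.TFAE
      [ IsLeftSelfInjective R,
        ∀ n : ℕ, IsUpperContinuous (FGLattice R (Fin n → R)),
        IsUpperContinuous (FGLattice R (Fin 2 → R)),
        IsUpperContinuous (FGLattice R R) ∧ IsCompleteOrder (FGLattice R (Fin 2 → R)),
        ∀ n : ℕ, IsLowerContinuous (FGLattice Rᵐᵒᵖ (Fin n → R)),
        IsLowerContinuous (FGLattice Rᵐᵒᵖ (Fin 2 → R)),
        IsLowerContinuous (FGLattice Rᵐᵒᵖ R) ∧ IsCompleteOrder (FGLattice Rᵐᵒᵖ (Fin 2 → R)) ] := by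
  have htfae := hR.isRegularModule.injective_tfae (LinearMap.id : R →ₗ[R] R) Function.injective_id
  have hpi (n : ℕ) := isUpperContinuous_iff_of_dual (hR.fgLatticePiIso (Fin n))
  tfae_have 1 ↔ 2 := htfae.out 0 1
  tfae_have 1 ↔ 3 := htfae.out 0 2
  tfae_have 1 ↔ 4 := htfae.out 0 3
  tfae_have 2 ↔ 5 := forall_congr' hpi
  tfae_have 3 ↔ 6 := hpi 2
  tfae_have 4 ↔ 7 := and_congr (isUpperContinuous_iff_of_dual hR.fgLatticeSelfIso)
    (isCompleteOrder_iff_of_dual (hR.fgLatticePiIso (Fin 2)))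
  tfae_finish

theorem isCompleteOrder_pi (hR : IsVNRegular R)
    (h : IsLeftSelfInjective R ∨ IsRightSelfInjective R) (n : ℕ) :
    IsCompleteOrder (FGLattice R (Fin n → R)) := by
  rcases h with (h : Module.Injective R R) | (h : Module.Injective Rᵐᵒᵖ R)
  · exact hR.isRegularModule.pi_const.isUpperContinuous_of_injective.complete
  · exact (isCompleteOrder_iff_of_dual (hR.fgLatticePiIso (Fin n))).2
      hR.isRegularModule_right.pi_const.isUpperContinuous_of_injective.complete

theorem isLeftPiCoherent (hR : IsVNRegular R)
    (hc : ∀ n : ℕ, IsCompleteOrder (FGLattice R (Fin n → R))) : IsLeftPiCoherent.{u, v} R :=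
  fun _ _ hN => IsRegularModule.finitePresentation_of_fg_pi (fun _ => hR.isRegularModule) hc hN

theorem isRightPiCoherent (hR : IsVNRegular R)
    (hc : ∀ n : ℕ, IsCompleteOrder (FGLattice R (Fin n → R))) : IsRightPiCoherent.{u, v} R := by
  refine fun _ _ => IsRegularModule.finitePresentation_of_fg_pi
    (fun _ => hR.isRegularModule_right) fun n => ?_
  exact ((isCompleteOrder_iff_of_dual (hR.fgLatticePiIso (Fin n))).1 (hc n)).congr
    (FGLattice.congr (LinearEquiv.piCongrRight fun _ => MulOpposite.opLinearEquiv Rᵐᵒᵖ))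

end IsVNRegular

theorem mainTheorem9 (R : Type u) [Ring R] (hR : IsVNRegular R) :
    List.TFAE
      [ IsRightSelfInjective R,
        ∀ n : ℕ, IsUpperContinuous (FGLattice Rᵐᵒᵖ (Fin n → R)),
        IsUpperContinuous (FGLattice Rᵐᵒᵖ (Fin 2 → R)),
        IsUpperContinuous (FGLattice Rᵐᵒᵖ R) ∧ IsCompleteOrder (FGLattice Rᵐᵒᵖ (Fin 2 → R)) ] ∧
    List.TFAE
      [ IsLeftSelfInjective R,
        ∀ n : ℕ, IsUpperContinuous (FGLattice R (Fin n → R)),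
        IsUpperContinuous (FGLattice R (Fin 2 → R)),
        IsUpperContinuous (FGLattice R R) ∧ IsCompleteOrder (FGLattice R (Fin 2 → R)),
        ∀ n : ℕ, IsLowerContinuous (FGLattice Rᵐᵒᵖ (Fin n → R)),
        IsLowerContinuous (FGLattice Rᵐᵒᵖ (Fin 2 → R)),
        IsLowerContinuous (FGLattice Rᵐᵒᵖ R) ∧ IsCompleteOrder (FGLattice Rᵐᵒᵖ (Fin 2 → R)) ] ∧
    (IsLeftSelfInjective R ∨ IsRightSelfInjective R →
      IsLeftPiCoherent.{u, v} R ∧ IsRightPiCoherent.{u, v} R) := by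
  refine ⟨hR.isRightSelfInjective_tfae, hR.isLeftSelfInjective_tfae, fun h => ?_⟩
  have hc : ∀ n : ℕ, IsCompleteOrder (FGLattice R (Fin n → R)) := hR.isCompleteOrder_pi h
  exact ⟨hR.isLeftPiCoherent hc, hR.isRightPiCoherent hc⟩
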